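/- Let $E_8$ be the $E_8$-lattice, that is, the free abelian group $\mathbb{Z}^8$ with the symmetric bilinear form whose Gram matrix in the standard basis is the Cartan matrix of type $E_8$, and let $O(E_8)$ be its group of isometries. A root of $E_8$ is a vector $x\in E_8$ with $(x,x)=2$, and $h\in O(E_8)$ is called rootless if the sublattice $(h-1)E_8=\{hx-x \mid x\in E_8\}$ contains no roots. Theorem. There is no rootless element of order $8$ in $O(E_8)$. -/

import Mathlib

/-- The group `O(B)` of isometries of a `ℤ`-module `M` carrying a bilinear form `B`: the
`ℤ`-linear automorphisms `h` of `M` with `B (h x) (h y) = B x y` for all `x`, `y`. -/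
def latticeIsometryGroup {M : Type*} [AddCommGroup M] (B : LinearMap.BilinForm ℤ M) :
    Subgroup (M ≃ₗ[ℤ] M) where
  carrier := {h | ∀ x y : M, B (h x) (h y) = B x y}
  mul_mem' := by
    intro a b ha hb x y
    rw [LinearEquiv.mul_apply, LinearEquiv.mul_apply, ha, hb]
  one_mem' := by
    intro x y
    rfl
  inv_mem' := by
    intro a ha x y
    have h := ha (a⁻¹ x) (a⁻¹ y)
    rw [← LinearEquiv.mul_apply, ← LinearEquiv.mul_apply, mul_inv_cancel] at h
    exact h.symm

/-- A root of a lattice is a vector of norm `2`, the norm of `x` being `B x x`. -/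
def IsLatticeRoot {M : Type*} [AddCommGroup M] (B : LinearMap.BilinForm ℤ M) (x : M) : Prop :=
  B x x = 2

/-- An isometry `h` is rootless if the sublattice `(h - 1) M` contains no roots. -/
def IsRootless {M : Type*} [AddCommGroup M] (B : LinearMap.BilinForm ℤ M)
    (h : latticeIsometryGroup B) : Prop :=
  ∀ x ∈ LinearMap.range (((h : M ≃ₗ[ℤ] M) : M →ₗ[ℤ] M) - LinearMap.id), ¬ IsLatticeRoot B x

/-- The bilinear form of the `E₈`-lattice: the lattice is `ℤ⁸`, whose standard basis is a set of
simple roots, and the Gram matrix of that basis is the Cartan matrix of type `E₈`. -/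
def formE8 : LinearMap.BilinForm ℤ (Fin 8 → ℤ) :=
  Matrix.toBilin' CartanMatrix.E₈

/-! Let `h` be a rootless isometry of 2-power order. It permutes the 135 nonzero singular classes of
`E₈/2E₈`; as 135 is odd, it fixes one. The norm-4 vectors of such a class form a frame, orthogonal
up to sign and spanning a sublattice of finite index, and `h` preserves it. If `f` lies in the frame
and `h² f ≠ ±f`, then `(h² f - f)/2` is a root (`exists_root_of_redTwo_eq`), and it equals `(h -
1)((f + h f)/2)`, where `(f + h f)/2` is a lattice vector since `h f ≡ f` modulo 2. Rootlessness
forbids this, so `h² f = ±f` on the whole frame and `h⁴ = 1`; order 8 is impossible. -/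

/-! ### The form and its reduction modulo 2 -/

/-- The quadratic form of the `E₈` Dynkin diagram over a commutative ring; over `ℤ` it is half the
norm of the `E₈`-lattice. -/
def quadE8 {R : Type*} [CommRing R] (x : Fin 8 → R) : R :=
  x 0 ^ 2 + x 1 ^ 2 + x 2 ^ 2 + x 3 ^ 2 + x 4 ^ 2 + x 5 ^ 2 + x 6 ^ 2 + x 7 ^ 2
    - x 0 * x 2 - x 2 * x 3 - x 1 * x 3 - x 3 * x 4 - x 4 * x 5 - x 5 * x 6 - x 6 * x 7

/-- The reflection `x ↦ x - (x, r) r`, where `(x, r)` is the polar form of `quadE8`. -/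
def reflE8 {R : Type*} [CommRing R] (r x : Fin 8 → R) : Fin 8 → R :=
  x - (quadE8 (x + r) - quadE8 x - quadE8 r) • r

/-- Reduction of integral vectors modulo `2`. -/
def redTwo (x : Fin 8 → ℤ) : Fin 8 → ZMod 2 := fun i => (x i : ZMod 2)

theorem formE8_self (x : Fin 8 → ℤ) : formE8 x x = 2 * quadE8 x := by
  simp [formE8, Matrix.toBilin'_apply, Fin.sum_univ_eight, CartanMatrix.E₈, quadE8]
  ring

theorem quadE8_redTwo (x : Fin 8 → ℤ) : quadE8 (redTwo x) = ((quadE8 x : ℤ) : ZMod 2) := by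
  simp [quadE8, redTwo]

theorem redTwo_reflE8 (r x : Fin 8 → ℤ) :
    redTwo (reflE8 r x) = reflE8 (redTwo r) (redTwo x) := by
  have h : redTwo (x + r) = redTwo x + redTwo r := by ext i; simp [redTwo]
  ext i
  simp only [reflE8, ← h, quadE8_redTwo]
  simp [redTwo]

theorem redTwo_eq_iff {x y : Fin 8 → ℤ} : redTwo x = redTwo y ↔ ∃ z, x = y + (2 : ℤ) • z := by
  constructor
  · intro h
    have h' : ∀ i, ∃ c, x i - y i = 2 * c := fun i => by
      have := congrFun h.symm i
      exact (ZMod.intCast_eq_intCast_iff_dvd_sub _ _ 2).mp this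
    choose z hz using h'
    refine ⟨z, funext fun i => ?_⟩
    have := hz i
    simp only [Pi.add_apply, Pi.smul_apply, smul_eq_mul]
    omega
  · rintro ⟨z, rfl⟩
    ext i
    have : (2 : ZMod 2) = 0 := rfl
    simp [redTwo, this]

theorem quadE8_add_add_quadE8_sub (x y : Fin 8 → ℤ) :
    quadE8 (x + y) + quadE8 (x - y) = 2 * quadE8 x + 2 * quadE8 y := by
  simp only [quadE8, Pi.add_apply, Pi.sub_apply]
  ring

theorem quadE8_pos {x : Fin 8 → ℤ} (hx : x ≠ 0) : 0 < quadE8 x := by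
  -- Completing squares along the three arms of the diagram, from their ends towards the branch node
  -- 3.
  have key : 120 * quadE8 x = 30 * (2 * x 0 - x 2) ^ 2 + 10 * (3 * x 2 - 2 * x 3) ^ 2
      + 30 * (2 * x 1 - x 3) ^ 2 + 30 * (2 * x 7 - x 6) ^ 2 + 10 * (3 * x 6 - 2 * x 5) ^ 2
      + 5 * (4 * x 5 - 3 * x 4) ^ 2 + 3 * (5 * x 4 - 4 * x 3) ^ 2 + 2 * x 3 ^ 2 := by
    simp only [quadE8]; ring
  by_contra hq
  apply hx
  have s1 := sq_nonneg (2 * x 0 - x 2)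
  have s2 := sq_nonneg (3 * x 2 - 2 * x 3)
  have s3 := sq_nonneg (2 * x 1 - x 3)
  have s4 := sq_nonneg (2 * x 7 - x 6)
  have s5 := sq_nonneg (3 * x 6 - 2 * x 5)
  have s6 := sq_nonneg (4 * x 5 - 3 * x 4)
  have s7 := sq_nonneg (5 * x 4 - 4 * x 3)
  have s8 := sq_nonneg (x 3)
  have e1 : 2 * x 0 - x 2 = 0 := pow_eq_zero_iff two_ne_zero |>.mp (by linarith)
  have e2 : 3 * x 2 - 2 * x 3 = 0 := pow_eq_zero_iff two_ne_zero |>.mp (by linarith)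
  have e3 : 2 * x 1 - x 3 = 0 := pow_eq_zero_iff two_ne_zero |>.mp (by linarith)
  have e4 : 2 * x 7 - x 6 = 0 := pow_eq_zero_iff two_ne_zero |>.mp (by linarith)
  have e5 : 3 * x 6 - 2 * x 5 = 0 := pow_eq_zero_iff two_ne_zero |>.mp (by linarith)
  have e6 : 4 * x 5 - 3 * x 4 = 0 := pow_eq_zero_iff two_ne_zero |>.mp (by linarith)
  have e7 : 5 * x 4 - 4 * x 3 = 0 := pow_eq_zero_iff two_ne_zero |>.mp (by linarith)
  have e8 : x 3 = 0 := pow_eq_zero_iff two_ne_zero |>.mp (by linarith)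
  ext i
  fin_cases i <;> simp <;> omega

/-- Two vectors of norm `4` that are congruent modulo `2` and not opposite or equal differ by twice
a root, and so is their sum. -/
theorem exists_root_of_redTwo_eq {f g : Fin 8 → ℤ} (hf : quadE8 f = 2) (hg : quadE8 g = 2)
    (hfg : redTwo g = redTwo f) (h1 : g ≠ f) (h2 : g ≠ -f) :
    ∃ z, g = f + (2 : ℤ) • z ∧ quadE8 z = 1 := by
  obtain ⟨z, rfl⟩ := redTwo_eq_iff.mp hfg
  refine ⟨z, rfl, ?_⟩
  have hz : 0 < quadE8 z := quadE8_pos fun h => h1 (by simp [h])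
  have hw : 0 < quadE8 (f + z) := quadE8_pos fun h => h2 (by
    have h' : z = -f := eq_neg_of_add_eq_zero_right h
    rw [h']; module)
  -- The parallelogram law gives `quadE8 (f + z) + quadE8 z = 2` with both terms positive, so both
  -- are 1.
  have h3 := quadE8_add_add_quadE8_sub (f + z) z
  rw [show f + z + z = f + (2 : ℤ) • z by module, add_sub_cancel_right] at h3
  omega

/-! ### Reflections in roots -/

theorem reflE8_add {r : Fin 8 → ℤ} (x y : Fin 8 → ℤ) :
    reflE8 r (x + y) = reflE8 r x + reflE8 r y := by
  ext i
  simp only [reflE8, quadE8, Pi.add_apply, Pi.sub_apply, Pi.smul_apply, smul_eq_mul]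
  ring

theorem quadE8_reflE8 {r : Fin 8 → ℤ} (hr : quadE8 r = 1) (x : Fin 8 → ℤ) :
    quadE8 (reflE8 r x) = quadE8 x := by
  have h : ∀ c : ℤ, quadE8 (x - c • r) =
      quadE8 x - c * (quadE8 (x + r) - quadE8 x - quadE8 r) + c ^ 2 * quadE8 r := by
    intro c
    simp only [quadE8, Pi.add_apply, Pi.sub_apply, Pi.smul_apply, smul_eq_mul]
    ring
  rw [reflE8, h, hr]
  ring

theorem reflE8_reflE8 {r : Fin 8 → ℤ} (hr : quadE8 r = 1) (x : Fin 8 → ℤ) :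
    reflE8 r (reflE8 r x) = x := by
  have h : ∀ c : ℤ, quadE8 (x - c • r + r) - quadE8 (x - c • r) - quadE8 r =
      quadE8 (x + r) - quadE8 x - quadE8 r - 2 * c * quadE8 r := by
    intro c
    simp only [quadE8, Pi.add_apply, Pi.sub_apply, Pi.smul_apply, smul_eq_mul]
    ring
  have h' := h (quadE8 (x + r) - quadE8 x - quadE8 r)
  change reflE8 r x - (quadE8 (reflE8 r x + r) - quadE8 (reflE8 r x) - quadE8 r) • r = x
  rw [← reflE8] at h'
  rw [h', hr, reflE8, hr]
  module

/-! ### Frames span -/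

/-- The vectors of norm `4` in the class `v` modulo `2` span a sublattice of finite index: a linear
functional which vanishes on them is zero. -/
def FrameSpans (v : Fin 8 → ZMod 2) : Prop :=
  ∀ φ : (Fin 8 → ℤ) →+ ℤ, (∀ f, quadE8 f = 2 → redTwo f = v → φ f = 0) → φ = 0

/-- The reflection is an isometric involution compatible with reduction, so it carries the frame of
one class onto that of the other. -/
theorem FrameSpans.of_reflE8 {r : Fin 8 → ℤ} (hr : quadE8 r = 1) {v : Fin 8 → ZMod 2}
    (hv : FrameSpans (reflE8 (redTwo r) v)) : FrameSpans v := by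
  intro φ hφ
  let s : (Fin 8 → ℤ) →+ (Fin 8 → ℤ) := AddMonoidHom.mk' (reflE8 r) reflE8_add
  obtain ⟨x, rfl⟩ : ∃ x, redTwo x = v := ⟨fun i => (v i).val, by ext i; simp [redTwo]⟩
  have h0 : φ.comp s = 0 := by
    refine hv _ fun f hf hfv => hφ _ ((quadE8_reflE8 hr f).trans hf) ?_
    change redTwo (reflE8 r f) = _
    rw [redTwo_reflE8, hfv, ← redTwo_reflE8, ← redTwo_reflE8, reflE8_reflE8 hr]
  refine AddMonoidHom.ext fun y => ?_
  have := DFunLike.congr_fun h0 (reflE8 r y)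
  simpa [s, reflE8_reflE8 hr] using this

/-- A set of roots whose reflections carry every nonzero singular class to `baseClass`. -/
def descentRoots : List (Fin 8 → ℤ) :=
  [![1, 0, 0, 0, 0, 0, 0, 0], ![0, 0, 1, 0, 0, 0, 0, 0], ![0, 0, 0, 1, 0, 0, 0, 0],
    ![0, 0, 0, 0, 0, 1, 0, 0], ![0, 1, 1, 2, 1, 0, 0, 0], ![1, 1, 2, 2, 2, 2, 1, 0],
    ![1, 1, 2, 2, 2, 1, 0, 0], ![1, 2, 2, 3, 3, 2, 1, 1]]

/-- The nonzero singular class of least weight. -/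
def baseClass : Fin 8 → ZMod 2 := ![0, 0, 1, 1, 0, 1, 1, 0]

/-- A weight on classes modulo `2` that suitable reflections decrease. -/
def classWeight (v : Fin 8 → ZMod 2) : ℕ :=
  (v 0).val + 4 * (v 1).val + 8 * (v 2 + 1).val + 32 * (v 3 + 1).val + 16 * (v 4).val
    + 2 * (v 5 + 1).val + 64 * (v 6 + 1).val + 128 * (v 7).val

theorem quadE8_of_mem_descentRoots : ∀ r ∈ descentRoots, quadE8 r = 1 := by decide

/-- This stands in for the transitivity of the Weyl group on nonzero singular classes. The weight
reads `v + baseClass` as a binary number with permuted digits, hence vanishes only at `baseClass`;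
the descent is checked over all 256 classes. -/
theorem exists_classWeight_lt : ∀ v : Fin 8 → ZMod 2, quadE8 v = 0 → v ≠ 0 → v ≠ baseClass →
    ∃ r ∈ descentRoots, classWeight (reflE8 (redTwo r) v) < classWeight v ∧
      quadE8 (reflE8 (redTwo r) v) = 0 ∧ reflE8 (redTwo r) v ≠ 0 := by
  decide +kernel

theorem card_singular_classes :
    Fintype.card {v : Fin 8 → ZMod 2 // quadE8 v = 0 ∧ v ≠ 0} = 135 := by
  decide +kernel

theorem frameSpans_baseClass : FrameSpans baseClass := by
  intro φ hφ
  have hφx : ∀ x : Fin 8 → ℤ, φ x = ∑ i, x i * φ (Pi.single i 1) := by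
    intro x
    have hx : x = ∑ i, x i • (Pi.single i 1 : Fin 8 → ℤ) := by
      ext j; simp [Finset.sum_apply, Pi.single_apply]
    conv_lhs => rw [hx]
    simp only [map_sum, map_zsmul, smul_eq_mul]
  -- One vector from each opposite pair of the frame. They are pairwise orthogonal, so the eight
  -- linear equations on the values of `φ` at the basis have only the zero solution.
  have h1 := hφ ![2, 4, 5, 7, 6, 5, 3, 2] (by decide) (by decide)
  have h2 := hφ ![0, 0, 1, 1, 0, -1, -1, 0] (by decide) (by decide)
  have h3 := hφ ![2, 2, 3, 5, 4, 3, 3, 2] (by decide) (by decide)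
  have h4 := hφ ![0, 0, 1, 1, 2, 1, 1, 0] (by decide) (by decide)
  have h5 := hφ ![0, 0, 1, 1, 0, 1, 1, 0] (by decide) (by decide)
  have h6 := hφ ![0, 2, 1, 3, 2, 1, 1, 0] (by decide) (by decide)
  have h7 := hφ ![2, 2, 3, 5, 4, 3, 1, 0] (by decide) (by decide)
  have h8 := hφ ![2, 2, 3, 3, 2, 1, 1, 0] (by decide) (by decide)
  rw [hφx] at h1 h2 h3 h4 h5 h6 h7 h8
  simp [Fin.sum_univ_eight] at h1 h2 h3 h4 h5 h6 h7 h8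
  ext i
  fin_cases i <;> simp <;> omega

theorem frameSpans_of_singular (v : Fin 8 → ZMod 2) (hq : quadE8 v = 0) (hv : v ≠ 0) :
    FrameSpans v := by
  induction hn : classWeight v using Nat.strong_induction_on generalizing v with
  | _ n ih =>
    by_cases hb : v = baseClass
    · exact hb ▸ frameSpans_baseClass
    · obtain ⟨r, hr, hlt, hq', hv'⟩ := exists_classWeight_lt v hq hv hb
      exact .of_reflE8 (quadE8_of_mem_descentRoots r hr) (ih _ (hn ▸ hlt) _ hq' hv' rfl)

/-! ### The fixed class and the fourth power -/

/-- A `ℤ`-linear isometry of `2`-power order fixes a nonzero singular class modulo `2`. -/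
theorem exists_fixed_singular_class (H : (Fin 8 → ℤ) ≃ₗ[ℤ] (Fin 8 → ℤ))
    (hH : ∀ x, quadE8 (H x) = quadE8 x) {n : ℕ} (hn : H ^ 2 ^ n = 1) :
    ∃ v : Fin 8 → ZMod 2, quadE8 v = 0 ∧ v ≠ 0 ∧ ∀ x, redTwo x = v → redTwo (H x) = v := by
  have hlift : ∀ v : Fin 8 → ZMod 2, redTwo (fun i => ((v i).val : ℤ)) = v := by
    intro v; ext i; simp [redTwo]
  have hcongr : ∀ x y, redTwo x = redTwo y → redTwo (H x) = redTwo (H y) := by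
    intro x y hxy
    obtain ⟨z, rfl⟩ := redTwo_eq_iff.mp hxy
    exact redTwo_eq_iff.mpr ⟨H z, by rw [map_add, map_smul]⟩
  have hzero : redTwo 0 = 0 := by ext i; simp [redTwo]
  have hne : ∀ x, redTwo x ≠ 0 → redTwo (H x) ≠ 0 := by
    intro x hx h0
    rw [← hzero] at h0
    obtain ⟨z, hz⟩ := redTwo_eq_iff.mp h0
    apply hx
    rw [← hzero]
    refine redTwo_eq_iff.mpr ⟨H.symm z, H.injective ?_⟩
    rw [hz, zero_add, zero_add, map_smul, LinearEquiv.apply_symm_apply]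
  let f : Function.End {v : Fin 8 → ZMod 2 // quadE8 v = 0 ∧ v ≠ 0} := fun v =>
    ⟨redTwo (H fun i => ((v.1 i).val : ℤ)), by
      rw [quadE8_redTwo, hH, ← quadE8_redTwo, hlift]; exact v.2.1,
      hne _ (by rw [hlift]; exact v.2.2)⟩
  have hf : ∀ v x, redTwo x = v.1 → redTwo (H x) = (f v).1 := fun v x hx =>
    hcongr _ _ (hx.trans (hlift v.1).symm)
  have hpow : ∀ k v x, redTwo x = v.1 → redTwo ((H ^ k) x) = ((f ^ k) v).1 := by
    intro k
    induction k with
    | zero => intro v x hx; exact hx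
    | succ k ih =>
      intro v x hx
      rw [pow_succ, pow_succ]
      exact ih (f v) (H x) (hf v x hx)
  have hf1 : f ^ 2 ^ n = 1 := by
    funext v
    apply Subtype.ext
    rw [← hpow (2 ^ n) v _ (hlift v.1), hn]
    exact hlift v.1
  -- For a map of 2-power order, the number of fixed points has the parity of the whole set, here
  -- odd.
  have hcard := Equiv.Perm.card_fixedPoints_modEq hf1
  rw [card_singular_classes] at hcard
  have hpos : Fintype.card f.fixedPoints ≠ 0 := by
    intro h0
    rw [h0] at hcard
    exact absurd hcard (by decide)
  obtain ⟨⟨v, hv⟩⟩ := Fintype.card_pos_iff.mp (Nat.pos_of_ne_zero hpos)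
  refine ⟨v.1, v.2.1, v.2.2, fun x hx => ?_⟩
  rw [hf v x hx]
  exact congrArg Subtype.val hv

/-- A rootless isometry of `2`-power order has fourth power `1`. -/
theorem IsRootless.pow_four_eq_one {h : latticeIsometryGroup formE8} (hr : IsRootless formE8 h)
    {n : ℕ} (hn : h ^ 2 ^ n = 1) : h ^ 4 = 1 := by
  obtain ⟨H, hHiso⟩ := h
  have hH : ∀ x, quadE8 (H x) = quadE8 x := by
    intro x
    have := hHiso x x
    rw [formE8_self, formE8_self] at this
    omega
  have hHn : H ^ 2 ^ n = 1 := congrArg Subtype.val hn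
  obtain ⟨v, hq, hv, hfix⟩ := exists_fixed_singular_class H hH hHn
  have hsq : ∀ f, quadE8 f = 2 → redTwo f = v → H (H f) = f ∨ H (H f) = -f := by
    intro f hf hfv
    by_contra! hne
    have hv1 := hfix f hfv
    have hv2 := hfix _ hv1
    obtain ⟨z, hz, hz1⟩ := exists_root_of_redTwo_eq hf (by rw [hH, hH, hf])
      (hv2.trans hfv.symm) hne.1 hne.2
    obtain ⟨w, hw⟩ := redTwo_eq_iff.mp (hv1.trans hfv.symm)
    -- The preimage `f + w` is `(f + H f)/2`, and `(H - 1)(f + H f) = H (H f) - f = 2z`.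
    refine hr z ⟨f + w, ?_⟩ (by rw [IsLatticeRoot, formE8_self, hz1]; rfl)
    have h2 : (2 : ℤ) • (H (f + w) - (f + w)) = (2 : ℤ) • z := by
      have e : (2 : ℤ) • (f + w) = f + H f := by rw [hw]; module
      rw [smul_sub, ← map_smul, e, map_add, hz]
      module
    exact smul_right_injective _ (two_ne_zero : (2 : ℤ) ≠ 0) h2
  have h4 : ∀ x, (H ^ 4) x = x := by
    intro x
    ext i
    -- The `i`-th coordinate of `H ^ 4 - 1`, a functional that vanishes on the frame.
    let φ : (Fin 8 → ℤ) →+ ℤ :=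
      (Pi.evalAddMonoidHom (fun _ => ℤ) i).comp
        ((((H ^ 4 : (Fin 8 → ℤ) ≃ₗ[ℤ] (Fin 8 → ℤ)) : (Fin 8 → ℤ) →ₗ[ℤ] (Fin 8 → ℤ))
          - LinearMap.id).toAddMonoidHom)
    have hφ : φ = 0 := by
      refine frameSpans_of_singular v hq hv φ fun f hf hfv => ?_
      have hf4 : (H ^ 4) f = f := by
        change H (H (H (H f))) = f
        rcases hsq f hf hfv with h | h <;> simp [h]
      simp [φ, hf4]
    have := DFunLike.congr_fun hφ x
    simpa [φ, sub_eq_zero] using this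
  exact Subtype.ext (LinearEquiv.ext h4)

theorem theorem4p17 :
    ¬ ∃ h : latticeIsometryGroup formE8, orderOf h = 8 ∧ IsRootless formE8 h := by
  rintro ⟨h, ho, hr⟩
  have h8 : h ^ 2 ^ 3 = 1 := by
    have := pow_orderOf_eq_one h
    rwa [ho] at this
  have := orderOf_dvd_of_pow_eq_one (hr.pow_four_eq_one h8)
  rw [ho] at this
  revert this
  decide
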